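/- Let $K$ be a field that is complete for a discrete valuation $\mathrm{val}$, normalized by $\mathrm{val}(\pi)=1$ for a uniformizer $\pi$, and let $|\cdot|$ be a corresponding absolute value, so that $|a| = |\pi|^{\mathrm{val}(a)}$ with $0<|\pi|<1$. For $n \ge 0$ and $\mathbf r = (r_1,\dots,r_n)\in\mathbb Q^n$ let $$K\{\mathbf X;\mathbf r\} = \Big\{ \sum_{\mathbf i\in\mathbb N^n} a_{\mathbf i}\mathbf X^{\mathbf i} \ :\ a_{\mathbf i}\in K,\ \mathrm{val}(a_{\mathbf i}) - \mathbf r\cdot\mathbf i \to +\infty \text{ as } |\mathbf i|\to+\infty\Big\}$$ be the Tate algebra with log-radii $\mathbf r$, and let $\big\|\sum a_{\mathbf i}\mathbf X^{\mathbf i}\big\|_{\mathbf r} = \sup_{\mathbf i} |a_{\mathbf i}|\,|\pi|^{-\mathbf r\cdot\mathbf i}$ be its Gauss norm. Let $\mathbf r,\mathbf u\in\mathbb Q^n$ with $r_i\ge u_i$ for all $i$, so that $K\{\mathbf X;\mathbf r\}\subset K\{\mathbf X;\mathbf u\}$. Let $I$ be an ideal of $K\{\mathbf X;\mathbf r\}$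 such that $V = K\{\mathbf X;\mathbf r\}/I$ is a finite-dimensional $K$-vector space, and let $J = I\cdot K\{\mathbf X;\mathbf u\}$ and $W = K\{\mathbf X;\mathbf u\}/J$. For $x\in V$ put $$\|x\|_V = \inf\{\, \|\hat x\|_{\mathbf u} \ :\ \hat x\in K\{\mathbf X;\mathbf r\} \text{ lifts } x\,\}, \qquad N = \{x\in V : \|x\|_V = 0\}.$$ Then the map $\Phi : V\to W$ induced by the inclusion $K\{\mathbf X;\mathbf r\}\subset K\{\mathbf X;\mathbf u\}$ is surjective and its kernel is $N$. -/

import Mathlib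

open Filter Topology

namespace Tate

/-- `π` is a uniformizer of the non-archimedean normed field `K`: `0 < ‖π‖ < 1` and every nonzero
element has absolute value an integral power of `‖π‖`. Thus the absolute value of `K` is
`‖x‖ = ‖π‖ ^ val x` for the discrete valuation `val : K → ℤ ∪ {∞}` with `val π = 1`. -/
structure IsUniformizer {K : Type*} [NormedField K] (π : K) : Prop where
  pos : 0 < ‖π‖
  lt_one : ‖π‖ < 1
  exists_zpow : ∀ x : K, x ≠ 0 → ∃ m : ℤ, ‖x‖ = ‖π‖ ^ m

/-- The radii `‖π‖ ^ (-r j)` with log-radii `r`. Then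
`‖a‖ * ∏ j, radius π r j ^ i j = ‖π‖ ^ (val a - r · i)`. -/
noncomputable def radius {K : Type*} [NormedField K] {n : ℕ} (π : K) (r : Fin n → ℚ) :
    Fin n → ℝ :=
  fun j => ‖π‖ ^ (-(r j : ℝ))

theorem radius_nonneg {K : Type*} [NormedField K] {n : ℕ} (π : K) (r : Fin n → ℚ) (j : Fin n) :
    0 ≤ radius π r j :=
  Real.rpow_nonneg (norm_nonneg π) _

theorem radius_le {K : Type*} [NormedField K] {n : ℕ} {π : K} (hπ : IsUniformizer π)
    {r u : Fin n → ℚ} (h : u ≤ r) (j : Fin n) : radius π u j ≤ radius π r j := by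
  refine Real.rpow_le_rpow_of_exponent_ge hπ.pos hπ.lt_one.le ?_
  have : (u j : ℝ) ≤ r j := by exact_mod_cast h j
  linarith

/-- The Tate algebra `K{X; r}`: the power series `∑ aᵢ Xⁱ` with `‖aᵢ‖ ‖π‖ ^ (-r · i) → 0`,
that is, `val aᵢ - r · i → +∞`, as `|i| → ∞` (see `mem_tateAlgebra_iff`). -/
noncomputable def tateAlgebra {K : Type*} [NormedField K] [IsUltrametricDist K] {n : ℕ}
    (π : K) (r : Fin n → ℚ) : Subalgebra K (MvPowerSeries (Fin n) K) where
  carrier := {f | MvPowerSeries.IsRestricted (radius π r) f}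
  mul_mem' := MvPowerSeries.isRestricted.mul (radius π r)
  add_mem' := MvPowerSeries.isRestricted.add (radius π r)
  algebraMap_mem' := MvPowerSeries.isRestricted_C (radius π r)

/-- Membership in `K{X; r}` in terms of the additive valuation `val a = logb ‖π‖ ‖a‖`
(`val 0 = +∞`). -/
theorem mem_tateAlgebra_iff {K : Type*} [NormedField K] [IsUltrametricDist K] {n : ℕ}
    {π : K} (hπ : IsUniformizer π) (r : Fin n → ℚ) (f : MvPowerSeries (Fin n) K) :
    f ∈ tateAlgebra π r ↔
      ∀ C : ℝ, ∀ᶠ i in cofinite, MvPowerSeries.coeff i f = 0 ∨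
        C < Real.logb ‖π‖ ‖MvPowerSeries.coeff i f‖ - ∑ j, (r j : ℝ) * (i j : ℝ) := by
  have key : ∀ i : Fin n →₀ ℕ, MvPowerSeries.coeff i f ≠ 0 →
      ‖MvPowerSeries.coeff i f‖ * i.prod (radius π r · ^ ·) =
        ‖π‖ ^ (Real.logb ‖π‖ ‖MvPowerSeries.coeff i f‖ - ∑ j, (r j : ℝ) * (i j : ℝ)) := by
    intro i hi
    rw [sub_eq_add_neg, Real.rpow_add hπ.pos,
      Real.rpow_logb hπ.pos hπ.lt_one.ne (norm_pos_iff.2 hi),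
      Finsupp.prod_fintype _ _ (by simp), ← Finset.sum_neg_distrib, Real.rpow_sum_of_pos hπ.pos]
    congr 1
    refine Finset.prod_congr rfl fun j _ => ?_
    rw [radius, ← Real.rpow_natCast, ← Real.rpow_mul hπ.pos.le, neg_mul]
  have hnn : ∀ i : Fin n →₀ ℕ,
      0 ≤ ‖MvPowerSeries.coeff i f‖ * i.prod (radius π r · ^ ·) := fun i =>
    mul_nonneg (norm_nonneg _)
      (Finset.prod_nonneg fun j _ => pow_nonneg (radius_nonneg π r j) _)
  change MvPowerSeries.IsRestricted _ _ ↔ _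
  rw [MvPowerSeries.IsRestricted, Metric.tendsto_nhds]
  constructor
  · intro h C
    filter_upwards [h (‖π‖ ^ C) (Real.rpow_pos_of_pos hπ.pos C)] with i hi
    by_cases h0 : MvPowerSeries.coeff i f = 0
    · exact Or.inl h0
    · right
      rw [Real.dist_0_eq_abs, abs_of_nonneg (hnn i), key i h0] at hi
      exact (Real.rpow_lt_rpow_left_iff_of_base_lt_one hπ.pos hπ.lt_one).1 hi
  · intro h ε hε
    filter_upwards [h (Real.logb ‖π‖ ε)] with i hi
    rw [Real.dist_0_eq_abs, abs_of_nonneg (hnn i)]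
    rcases eq_or_ne (MvPowerSeries.coeff i f) 0 with h0 | h0
    · simpa [h0] using hε
    · rw [key i h0, ← Real.rpow_logb hπ.pos hπ.lt_one.ne hε]
      exact (Real.rpow_lt_rpow_left_iff_of_base_lt_one hπ.pos hπ.lt_one).2
        (hi.resolve_left h0)

theorem tateAlgebra_le {K : Type*} [NormedField K] [IsUltrametricDist K] {n : ℕ}
    {π : K} (hπ : IsUniformizer π) {r u : Fin n → ℚ} (h : u ≤ r) :
    tateAlgebra π r ≤ tateAlgebra π u := by
  intro f hf
  change MvPowerSeries.IsRestricted _ _ at hf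
  change MvPowerSeries.IsRestricted _ _
  refine tendsto_const_nhds.squeeze hf (fun i => ?_) (fun i => ?_)
  · exact mul_nonneg (norm_nonneg _)
      (Finset.prod_nonneg fun j _ => pow_nonneg (radius_nonneg π u j) _)
  · exact mul_le_mul_of_nonneg_left
      (Finset.prod_le_prod (fun j _ => pow_nonneg (radius_nonneg π u j) _)
        fun j _ => pow_le_pow_left₀ (radius_nonneg π u j) (radius_le hπ h j) _)
      (norm_nonneg _)

/-- The inclusion `K{X; r} → K{X; u}` for `u ≤ r`. -/
noncomputable def incl {K : Type*} [NormedField K] [IsUltrametricDist K] {n : ℕ}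
    {π : K} (hπ : IsUniformizer π) {r u : Fin n → ℚ} (h : u ≤ r) :
    tateAlgebra π r →ₐ[K] tateAlgebra π u :=
  Subalgebra.inclusion (tateAlgebra_le hπ h)

/-- The natural map `Φ : K{X; r} / I → K{X; u} / (I · K{X; u})`. -/
noncomputable def Phi {K : Type*} [NormedField K] [IsUltrametricDist K] {n : ℕ}
    {π : K} (hπ : IsUniformizer π) {r u : Fin n → ℚ} (h : u ≤ r)
    (I : Ideal (tateAlgebra π r)) :
    (tateAlgebra π r ⧸ I) →ₐ[K] (tateAlgebra π u ⧸ I.map (incl hπ h)) :=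
  Ideal.quotientMapₐ (I.map (incl hπ h)) (incl hπ h) Ideal.le_comap_map

/-- The Gauss norm `‖f‖_u = sup_i ‖aᵢ‖ ‖π‖ ^ (-u · i)`, i.e. `‖π‖ ^ (val_u f)`. -/
noncomputable def gaussNorm {K : Type*} [NormedField K] {n : ℕ}
    (π : K) (u : Fin n → ℚ) (f : MvPowerSeries (Fin n) K) : ℝ :=
  MvPowerSeries.gaussNorm (fun a : K => ‖a‖) (radius π u) f

/-- The induced semi-norm `‖x‖_V = inf ‖f‖_u` on `V = K{X; r} / I`, the infimum being over all
`f ∈ K{X; r}` lifting `x`. -/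
noncomputable def quotSeminorm {K : Type*} [NormedField K] [IsUltrametricDist K] {n : ℕ}
    {π : K} {r : Fin n → ℚ} (u : Fin n → ℚ) (I : Ideal (tateAlgebra π r))
    (x : tateAlgebra π r ⧸ I) : ℝ :=
  sInf {t : ℝ | ∃ f : tateAlgebra π r,
    Ideal.Quotient.mk I f = x ∧ gaussNorm π u (f : MvPowerSeries (Fin n) K) = t}

end Tate

/-! Since V is finite-dimensional, the class of each variable X_j is algebraic over K, so I contains
a nonzero polynomial p_j(X_j). After scaling, p_j is distinguished of some degree s_j for the radius
attached to u_j. Weierstrass division by all the p_j at once writes every f in K{X;u} as ∑ q_j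
p_j(X_j) + e, where e is a polynomial with exponents in the finite box i_j < s_j and any bound t > 0
on the Gauss norm of f also bounds that of e (`exists_division`, `exists_finite_remainder`). As e
lies in K{X;r}, Φ is surjective.

For the kernel, J is compared with the closure of I under ‖·‖_u. Polynomials are dense in K{X;u}, so
elements of J are limits of elements of I (`exists_coeffBound_sub_of_mem_map`). Conversely J is
closed: the bound on e reduces this to a subspace of a finite-dimensional space over the complete
field K (`Tate.mem_map_of_forall_coeffBound`). Finally, ‖x‖_V = 0 says that a lift of x lies in the
closure of I (`quotSeminorm_eq_zero_iff`). -/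

namespace MvPowerSeries

/-! ### Weighted bounds on coefficients, truncation and completeness. -/

section CoeffBound

variable {σ K : Type*} [NormedField K]

/-- The coefficients of `f`, weighted by the radii `ρ`, are bounded by `t`; for `t ≥ 0` this says
that the Gauss norm of `f` is finite and at most `t`. -/
def CoeffBound (ρ : σ → ℝ) (f : MvPowerSeries σ K) (t : ℝ) : Prop :=
  ∀ i : σ →₀ ℕ, ‖coeff i f‖ * i.prod (ρ · ^ ·) ≤ t

variable {ρ : σ → ℝ} {f g : MvPowerSeries σ K} {s t : ℝ}

theorem weight_pos (hρ : ∀ j, 0 < ρ j) (i : σ →₀ ℕ) : 0 < i.prod (ρ · ^ ·) :=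
  Finset.prod_pos fun j _ => pow_pos (hρ j) _

theorem weight_add (ρ : σ → ℝ) (i k : σ →₀ ℕ) :
    (i + k).prod (ρ · ^ ·) = i.prod (ρ · ^ ·) * k.prod (ρ · ^ ·) :=
  Finsupp.prod_add_index' (fun _ => pow_zero _) fun _ _ _ => pow_add _ _ _

theorem weight_single (ρ : σ → ℝ) (j : σ) (k : ℕ) :
    (Finsupp.single j k).prod (ρ · ^ ·) = ρ j ^ k :=
  Finsupp.prod_single_index (pow_zero _)

namespace CoeffBound

theorem mono (h : CoeffBound ρ f s) (hst : s ≤ t) : CoeffBound ρ f t := fun i => (h i).trans hst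

theorem zero (ht : 0 ≤ t) : CoeffBound ρ (0 : MvPowerSeries σ K) t := fun i => by simpa using ht

theorem neg (h : CoeffBound ρ f t) : CoeffBound ρ (-f) t := fun i => by simpa using h i

theorem eq_zero (hρ : ∀ j, 0 < ρ j) (h : CoeffBound ρ f 0) : f = 0 := by
  ext i
  have := h i
  have hw := weight_pos hρ i
  have h0 : ‖coeff i f‖ ≤ 0 := by
    by_contra hc
    exact absurd this (not_le.2 (mul_pos (not_le.1 hc) hw))
  simpa using h0

theorem smul (a : K) (h : CoeffBound ρ f t) : CoeffBound ρ (a • f) (‖a‖ * t) := fun i => by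
  rw [coeff_smul, norm_mul, mul_assoc]
  exact mul_le_mul_of_nonneg_left (h i) (norm_nonneg a)

theorem monomial (hρ : ∀ j, 0 < ρ j) (i : σ →₀ ℕ) (a : K) :
    CoeffBound ρ (MvPowerSeries.monomial i a) (‖a‖ * i.prod (ρ · ^ ·)) := by
  classical
  intro k
  rw [coeff_monomial]
  split_ifs with h
  · rw [h]
  · simpa using mul_nonneg (norm_nonneg a) (weight_pos hρ i).le

theorem of_isRestricted (h : IsRestricted ρ f) : ∃ t > 0, CoeffBound ρ f t := by
  have hb := h.bddAbove_range_of_cofinite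
  obtain ⟨t, ht⟩ := hb
  exact ⟨max t 1, by positivity, fun i => (ht ⟨i, rfl⟩).trans (le_max_left _ _)⟩

section Ultrametric

variable [IsUltrametricDist K]

theorem add (hρ : ∀ j, 0 < ρ j) (hf : CoeffBound ρ f t) (hg : CoeffBound ρ g t) :
    CoeffBound ρ (f + g) t := fun i => by
  rw [map_add]
  have hw := (weight_pos hρ i).le
  refine (mul_le_mul_of_nonneg_right (IsUltrametricDist.norm_add_le_max _ _) hw).trans ?_
  rw [max_mul_of_nonneg _ _ hw]
  exact max_le (hf i) (hg i)

theorem sub (hρ : ∀ j, 0 < ρ j) (hf : CoeffBound ρ f t) (hg : CoeffBound ρ g t) :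
    CoeffBound ρ (f - g) t := by
  rw [sub_eq_add_neg]
  exact hf.add hρ hg.neg

theorem sum {ι : Type*} (hρ : ∀ j, 0 < ρ j) (ht : 0 ≤ t) (S : Finset ι)
    {F : ι → MvPowerSeries σ K} (h : ∀ k ∈ S, CoeffBound ρ (F k) t) :
    CoeffBound ρ (∑ k ∈ S, F k) t :=
  Finset.sum_induction F (CoeffBound ρ · t) (fun _ _ => CoeffBound.add hρ) (zero ht) h

theorem mul (hρ : ∀ j, 0 < ρ j) (hs : 0 ≤ s) (ht : 0 ≤ t) (hf : CoeffBound ρ f s)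
    (hg : CoeffBound ρ g t) : CoeffBound ρ (f * g) (s * t) := fun i => by
  classical
  have hw := weight_pos hρ i
  rw [coeff_mul, ← le_div_iff₀ hw]
  refine IsUltrametricDist.norm_sum_le_of_forall_le_of_nonneg (by positivity) fun p hp => ?_
  rw [Finset.HasAntidiagonal.mem_antidiagonal] at hp
  rw [le_div_iff₀ hw, ← hp, weight_add, norm_mul, mul_mul_mul_comm]
  exact mul_le_mul (hf _) (hg _) (mul_nonneg (norm_nonneg _) (weight_pos hρ _).le) hs

end Ultrametric

end CoeffBound

theorem isRestricted_of_support_subset {S : Set (σ →₀ ℕ)} (hS : S.Finite)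
    (h : ∀ i ∉ S, coeff i f = 0) (ρ : σ → ℝ) : IsRestricted ρ f :=
  tendsto_nhds_of_eventually_eq <| hS.subset fun i hi => by
    by_contra hc
    exact hi (by simp [h i hc])

theorem isRestricted_sum {ι : Type*} (S : Finset ι) {F : ι → MvPowerSeries σ K}
    (h : ∀ k ∈ S, IsRestricted ρ (F k)) : IsRestricted ρ (∑ k ∈ S, F k) :=
  Finset.sum_induction F (IsRestricted ρ) (fun _ _ => isRestricted.add ρ) (isRestricted_zero ρ) h

theorem isRestricted_sub (hf : IsRestricted ρ f) (hg : IsRestricted ρ g) :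
    IsRestricted ρ (f - g) := by
  rw [sub_eq_add_neg]
  exact isRestricted.add ρ hf (isRestricted.neg ρ hg)

/-- A restricted power series is approximated by its truncations to finite sets of exponents. -/
theorem exists_sum_monomial_coeffBound (hf : IsRestricted ρ f)
    {ε : ℝ} (hε : 0 < ε) :
    ∃ S : Finset (σ →₀ ℕ), CoeffBound ρ (f - ∑ i ∈ S, coeff i f • monomial i (1 : K)) ε := by
  classical
  have h : {i | ¬ ‖coeff i f‖ * i.prod (ρ · ^ ·) < ε}.Finite := hf.eventually_lt_const hε
  refine ⟨h.toFinset, fun i => ?_⟩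
  have hc : coeff i (∑ k ∈ h.toFinset, coeff k f • monomial k (1 : K)) =
      if i ∈ h.toFinset then coeff i f else 0 := by
    simp [map_sum, coeff_monomial]
  rw [map_sub, hc]
  split_ifs with hi
  · simpa using hε.le
  · rw [Set.Finite.mem_toFinset, Set.mem_ofPred_eq, not_not] at hi
    simpa using hi.le

section Complete

variable [IsUltrametricDist K] [CompleteSpace K]

/-- Completeness of the restricted power series, for geometrically bounded series. -/
theorem exists_isRestricted_sum (hρ : ∀ j, 0 < ρ j) {c : ℝ} (hc0 : 0 ≤ c) (hc1 : c < 1)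
    (ht : 0 ≤ t) {F : ℕ → MvPowerSeries σ K} (hF : ∀ l, IsRestricted ρ (F l))
    (hb : ∀ l, CoeffBound ρ (F l) (t * c ^ l)) :
    ∃ G : MvPowerSeries σ K, IsRestricted ρ G ∧
      (∀ m, CoeffBound ρ (G - ∑ l ∈ Finset.range m, F l) (t * c ^ m)) ∧
      ∀ i, (∀ l, coeff i (F l) = 0) → coeff i G = 0 := by
  have hsum (i : σ →₀ ℕ) : Summable fun l => coeff i (F l) := by
    refine Summable.of_norm_bounded
      (g := fun l => t / i.prod (ρ · ^ ·) * c ^ l)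
      ((summable_geometric_of_lt_one hc0 hc1).mul_left _) fun l => ?_
    rw [div_mul_eq_mul_div, le_div_iff₀ (weight_pos hρ i)]
    exact hb l i
  let G : MvPowerSeries σ K := fun i => ∑' l, coeff i (F l)
  have hG (i : σ →₀ ℕ) : coeff i G = ∑' l, coeff i (F l) := rfl
  have hGb : ∀ m, CoeffBound ρ (G - ∑ l ∈ Finset.range m, F l) (t * c ^ m) := by
    intro m i
    -- The bound holds for every block of terms from m to M by the ultrametric inequality; it
    -- survives the limit in M.
    have hlim : Tendsto
        (fun M => ‖∑ l ∈ Finset.range M, coeff i (F l) - ∑ l ∈ Finset.range m, coeff i (F l)‖ *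
          i.prod (ρ · ^ ·)) atTop
        (𝓝 (‖coeff i (G - ∑ l ∈ Finset.range m, F l)‖ * i.prod (ρ · ^ ·))) := by
      rw [map_sub, hG, map_sum]
      exact (((hsum i).hasSum.tendsto_sum_nat.sub_const _).norm).mul_const _
    refine le_of_tendsto hlim ?_
    filter_upwards [eventually_ge_atTop m] with M hM
    rw [← Finset.sum_Ico_eq_sub _ hM, ← map_sum]
    refine CoeffBound.sum hρ (by positivity) _ (fun l hl => (hb l).mono ?_) i
    exact mul_le_mul_of_nonneg_left
      (pow_le_pow_of_le_one hc0 hc1.le (Finset.mem_Ico.1 hl).1) ht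
  refine ⟨G, ?_, hGb, fun i hi => by simp [hG, hi]⟩
  rw [IsRestricted, Metric.tendsto_nhds]
  intro ε hε
  have hlim : Tendsto (fun m => t * c ^ m) atTop (𝓝 0) := by
    simpa using (tendsto_pow_atTop_nhds_zero_of_lt_one hc0 hc1).const_mul t
  obtain ⟨m, hm⟩ := (hlim.eventually_lt_const hε).exists
  have hr : IsRestricted ρ (∑ l ∈ Finset.range m, F l) := isRestricted_sum _ fun l _ => hF l
  filter_upwards [hr.eventually_lt_const hε] with i hi
  have hw := weight_pos hρ i
  rw [Real.dist_0_eq_abs, abs_of_nonneg (by positivity)]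
  rw [← sub_add_cancel G (∑ l ∈ Finset.range m, F l), map_add]
  refine (mul_le_mul_of_nonneg_right (IsUltrametricDist.norm_add_le_max _ _) hw.le).trans_lt ?_
  rw [max_mul_of_nonneg _ _ hw.le]
  exact max_lt ((hGb m i).trans_lt hm) hi

end Complete

end CoeffBound

end MvPowerSeries

namespace MvPowerSeries

/-! ### Simultaneous Weierstrass division by one-variable polynomials. -/

section Division

variable {σ K : Type*} [NormedField K]

/-- The polynomial `p` in the variable `X j`, as a power series. -/
noncomputable def ofPolynomial (j : σ) (p : Polynomial K) : MvPowerSeries σ K :=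
  p.sum fun k a => monomial (Finsupp.single j k) a

theorem isRestricted_ofPolynomial (ρ : σ → ℝ) (j : σ) (p : Polynomial K) :
    IsRestricted ρ (ofPolynomial j p) :=
  isRestricted_sum _ fun _ _ => isRestricted_monomial _ _ _

theorem monomial_mul_ofPolynomial (m : σ →₀ ℕ) (j : σ) (p : Polynomial K) :
    monomial m 1 * ofPolynomial j p =
      ∑ k ∈ p.support, p.coeff k • monomial (m + Finsupp.single j k) (1 : K) := by
  rw [ofPolynomial, Polynomial.sum, Finset.mul_sum]
  refine Finset.sum_congr rfl fun k _ => ?_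
  rw [monomial_mul_monomial, one_mul, ← map_smul, smul_eq_mul, mul_one]

/-- The polynomial `p` has coefficient one in degree `s`, this coefficient attains the Gauss norm
of radius `ρ`, and the terms of larger degree are smaller by a factor `c`. -/
structure IsDistinguished (ρ c : ℝ) (s : ℕ) (p : Polynomial K) : Prop where
  coeff_eq_one : p.coeff s = 1
  le : ∀ k, ‖p.coeff k‖ * ρ ^ k ≤ ρ ^ s
  le_of_lt : ∀ k, s < k → ‖p.coeff k‖ * ρ ^ k ≤ c * ρ ^ s

/-- Up to a scalar, a nonzero polynomial over a field is distinguished in the degree of the last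
coefficient attaining the Gauss norm. -/
theorem exists_isDistinguished {ρ : ℝ} (hρ : 0 < ρ) {p : Polynomial K} (hp : p ≠ 0) :
    ∃ c < (1 : ℝ), ∃ s : ℕ, ∃ a : K, IsDistinguished ρ c s (Polynomial.C a * p) := by
  classical
  obtain ⟨m, hm, hmax⟩ := p.support.exists_max_image (fun k => ‖p.coeff k‖ * ρ ^ k)
    (Polynomial.support_nonempty.2 hp)
  let T := p.support.filter fun k => ‖p.coeff k‖ * ρ ^ k = ‖p.coeff m‖ * ρ ^ m
  have hT : T.Nonempty := ⟨m, by simp [T, Polynomial.mem_support_iff.1 hm]⟩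
  obtain ⟨hs, hsm⟩ := Finset.mem_filter.1 (T.max'_mem hT)
  set s := T.max' hT
  have hle (k : ℕ) : ‖p.coeff k‖ * ρ ^ k ≤ ‖p.coeff s‖ * ρ ^ s := by
    by_cases hk : k ∈ p.support
    · exact (hmax k hk).trans hsm.ge
    · rw [Polynomial.notMem_support_iff.1 hk]
      simpa using by positivity
  have hlt (k : ℕ) (hk : s < k) : ‖p.coeff k‖ * ρ ^ k < ‖p.coeff s‖ * ρ ^ s := by
    refine lt_of_le_of_ne (hle k) fun h => ?_
    have hs0 : 0 < ‖p.coeff s‖ := norm_pos_iff.2 (Polynomial.mem_support_iff.1 hs)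
    have hk0 : p.coeff k ≠ 0 := fun h0 => by
      have : 0 < ‖p.coeff s‖ * ρ ^ s := by positivity
      rw [← h, h0] at this
      simp at this
    exact absurd (T.le_max' k (Finset.mem_filter.2
      ⟨Polynomial.mem_support_iff.2 hk0, h.trans hsm⟩)) (not_le.2 hk)
  have hs0 : 0 < ‖p.coeff s‖ := norm_pos_iff.2 (Polynomial.mem_support_iff.1 hs)
  have key (k : ℕ) (d : ℝ) (h : ‖p.coeff k‖ * ρ ^ k ≤ d * (‖p.coeff s‖ * ρ ^ s)) :
      ‖(Polynomial.C (p.coeff s)⁻¹ * p).coeff k‖ * ρ ^ k ≤ d * ρ ^ s := by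
    rw [Polynomial.coeff_C_mul, norm_mul, norm_inv, mul_assoc, inv_mul_le_iff₀ hs0]
    linarith
  obtain ⟨c, hc1, hc⟩ : ∃ c < (1 : ℝ), ∀ k ∈ p.support, s < k →
      ‖p.coeff k‖ * ρ ^ k ≤ c * (‖p.coeff s‖ * ρ ^ s) := by
    have hpos : 0 < ‖p.coeff s‖ * ρ ^ s := by positivity
    -- Only finitely many strict inequalities are involved, so one c just below 1 serves them all.
    have : ∀ᶠ c in 𝓝[<] (1 : ℝ), ∀ k ∈ p.support, s < k →
        ‖p.coeff k‖ * ρ ^ k ≤ c * (‖p.coeff s‖ * ρ ^ s) := by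
      rw [Filter.eventually_all_finset]
      intro k _
      by_cases hk : s < k
      · have h1 := (div_lt_one hpos).2 (hlt k hk)
        filter_upwards [mem_nhdsWithin_of_mem_nhds (lt_mem_nhds h1)] with c hc _
        exact ((div_lt_iff₀ hpos).1 hc).le
      · exact Eventually.of_forall fun c h => absurd h hk
    obtain ⟨c, hc, hc1⟩ := (this.and self_mem_nhdsWithin).exists
    exact ⟨c, hc1, hc⟩
  -- Nothing forces c ≥ 0 when s is the top degree, whereas the vanishing coefficients need a
  -- nonnegative bound.
  have hc' (k : ℕ) (hk : s < k) : ‖p.coeff k‖ * ρ ^ k ≤ max c 0 * (‖p.coeff s‖ * ρ ^ s) := by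
    by_cases h : k ∈ p.support
    · exact (hc k h hk).trans (mul_le_mul_of_nonneg_right (le_max_left _ _) (by positivity))
    · rw [Polynomial.notMem_support_iff.1 h]
      simpa using by positivity
  refine ⟨max c 0, max_lt hc1 one_pos, s, (p.coeff s)⁻¹, ?_, fun k => ?_, fun k hk => ?_⟩
  · rw [Polynomial.coeff_C_mul, inv_mul_cancel₀ (norm_pos_iff.1 hs0)]
  · simpa using key k 1 (by simpa using hle k)
  · exact key k _ (hc' k hk)

variable [Fintype σ]

/-- `f = ∑ j, q j * P j + e` up to an error bounded by `t'`, where `e` has exponents in `S`, and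
`e` and the `q j` are bounded by `t` and `C * t`. -/
def ApproxDivision (ρ : σ → ℝ) (P : σ → MvPowerSeries σ K) (S : Set (σ →₀ ℕ)) (C t t' : ℝ)
    (f : MvPowerSeries σ K) : Prop :=
  ∃ (q : σ → MvPowerSeries σ K) (e : MvPowerSeries σ K),
    (∀ j, IsRestricted ρ (q j)) ∧ (∀ j, CoeffBound ρ (q j) (C * t)) ∧
    (∀ i ∉ S, coeff i e = 0) ∧ CoeffBound ρ e t ∧ CoeffBound ρ (f - (∑ j, q j * P j + e)) t'

variable {ρ : σ → ℝ} {P : σ → MvPowerSeries σ K} {S : Set (σ →₀ ℕ)} {C t t' u u' : ℝ}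
  {f g : MvPowerSeries σ K}

namespace ApproxDivision

theorem of_coeffBound (hC : 0 ≤ C) (ht : 0 ≤ t) (h : CoeffBound ρ f t') :
    ApproxDivision ρ P S C t t' f :=
  ⟨0, 0, fun _ => isRestricted_zero ρ, fun _ => CoeffBound.zero (by positivity),
    fun _ _ => map_zero _, CoeffBound.zero ht, by simpa using h⟩

theorem of_support (hC : 0 ≤ C) (ht : 0 ≤ t) (ht' : 0 ≤ t') (h : CoeffBound ρ f t)
    (hS : ∀ i ∉ S, coeff i f = 0) : ApproxDivision ρ P S C t t' f :=
  ⟨0, f, fun _ => isRestricted_zero ρ, fun _ => CoeffBound.zero (by positivity),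
    hS, h, by simpa using CoeffBound.zero ht'⟩

theorem mul (hC : 0 ≤ C) (ht : 0 ≤ t) (ht' : 0 ≤ t') (hf : IsRestricted ρ f)
    (h : CoeffBound ρ f (C * t)) (j : σ) : ApproxDivision ρ P S C t t' (f * P j) := by
  classical
  refine ⟨Pi.single j f, 0, fun k => ?_, fun k => ?_, fun _ _ => map_zero _, CoeffBound.zero ht, ?_⟩
  · rcases eq_or_ne k j with rfl | hk
    · simpa using hf
    · simpa [hk] using isRestricted_zero ρ
  · rcases eq_or_ne k j with rfl | hk
    · simpa using h
    · simpa [hk] using CoeffBound.zero (mul_nonneg hC ht)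
  · have : ∑ k, (Pi.single j f : σ → MvPowerSeries σ K) k * P k = f * P j := by
      simp [Pi.single_apply, ite_mul]
    simpa [this] using CoeffBound.zero ht'

theorem mono (hC : 0 ≤ C) (h : ApproxDivision ρ P S C t t' f) (htu : t ≤ u) (htu' : t' ≤ u') :
    ApproxDivision ρ P S C u u' f := by
  obtain ⟨q, e, hq, hqb, he, heb, hr⟩ := h
  exact ⟨q, e, hq, fun j => (hqb j).mono (mul_le_mul_of_nonneg_left htu hC), he, heb.mono htu,
    hr.mono htu'⟩

theorem smul (a : K) (h : ApproxDivision ρ P S C t t' f) :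
    ApproxDivision ρ P S C (‖a‖ * t) (‖a‖ * t') (a • f) := by
  obtain ⟨q, e, hq, hqb, he, heb, hr⟩ := h
  refine ⟨fun j => a • q j, a • e, fun j => ?_, fun j => ?_, fun i hi => ?_, heb.smul a, ?_⟩
  · have : Tendsto (fun i : σ →₀ ℕ => ‖a‖ * (‖coeff i (q j)‖ * i.prod (ρ · ^ ·)))
        cofinite (𝓝 0) := by
      simpa using (hq j).const_mul ‖a‖
    exact this.congr fun i => by rw [coeff_smul, norm_mul, mul_assoc]
  · exact ((hqb j).smul a).mono (mul_left_comm _ _ _).le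
  · rw [coeff_smul, he i hi, mul_zero]
  · have : a • f - (∑ j, a • q j * P j + a • e) = a • (f - (∑ j, q j * P j + e)) := by
      simp only [smul_sub, smul_add, Finset.smul_sum, smul_mul_assoc]
    rw [this]
    exact hr.smul a

variable [IsUltrametricDist K]

theorem add (hρ : ∀ j, 0 < ρ j) (hf : ApproxDivision ρ P S C t t' f)
    (hg : ApproxDivision ρ P S C t t' g) : ApproxDivision ρ P S C t t' (f + g) := by
  obtain ⟨q, e, hq, hqb, he, heb, hr⟩ := hf
  obtain ⟨q', e', hq', hqb', he', heb', hr'⟩ := hg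
  refine ⟨q + q', e + e', fun j => isRestricted.add ρ (hq j) (hq' j),
    fun j => (hqb j).add hρ (hqb' j), fun i hi => by rw [map_add, he i hi, he' i hi, add_zero],
    heb.add hρ heb', ?_⟩
  have : f + g - (∑ j, (q + q') j * P j + (e + e')) =
      (f - (∑ j, q j * P j + e)) + (g - (∑ j, q' j * P j + e')) := by
    simp only [Pi.add_apply, add_mul, Finset.sum_add_distrib]
    ring
  rw [this]
  exact hr.add hρ hr'

theorem sum {ι : Type*} (hρ : ∀ j, 0 < ρ j) (hC : 0 ≤ C) (ht : 0 ≤ t) (ht' : 0 ≤ t')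
    (T : Finset ι) {F : ι → MvPowerSeries σ K} (h : ∀ k ∈ T, ApproxDivision ρ P S C t t' (F k)) :
    ApproxDivision ρ P S C t t' (∑ k ∈ T, F k) :=
  Finset.sum_induction F (ApproxDivision ρ P S C t t') (fun _ _ => add hρ)
    (of_coeffBound hC ht (CoeffBound.zero ht')) h

end ApproxDivision

variable [IsUltrametricDist K]

/-- Approximate division of monomials by distinguished polynomials in the single variables. -/
theorem approxDivision_monomial (hρ : ∀ j, 0 < ρ j) {c : ℝ} (hc0 : 0 ≤ c) (hC : 0 ≤ C)
    {p : σ → Polynomial K} {s : σ → ℕ} (hp : ∀ j, IsDistinguished (ρ j) c (s j) (p j))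
    (hCs : ∀ j, 1 ≤ C * ρ j ^ s j) (i : σ →₀ ℕ) :
    ApproxDivision ρ (fun j => ofPolynomial j (p j)) {i | ∀ j, i j < s j} C
      (i.prod (ρ · ^ ·)) (c * i.prod (ρ · ^ ·)) (monomial i 1) := by
  classical
  induction hd : i.degree using Nat.strong_induction_on generalizing i with
  | _ d ih =>
  have hw := weight_pos hρ i
  by_cases hi : ∀ j, i j < s j
  · refine ApproxDivision.of_support hC hw.le (by positivity) ?_ fun k hk => ?_
    · simpa using CoeffBound.monomial hρ i (1 : K)
    · rw [coeff_monomial, if_neg]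
      rintro rfl
      exact hk hi
  push Not at hi
  obtain ⟨j, hj⟩ := hi
  obtain ⟨m, rfl⟩ : ∃ m, i = m + Finsupp.single j (s j) :=
    ⟨i - Finsupp.single j (s j), (tsub_add_cancel_of_le (Finsupp.single_le_iff.2 hj)).symm⟩
  have hwm := weight_pos hρ m
  rw [weight_add, weight_single] at hw ⊢
  have hs : s j ∈ (p j).support := by simp [(hp j).coeff_eq_one]
  -- Replace X_j^(s j) using p_j: terms with k < s j have smaller total degree and fall to the
  -- induction, while terms with k > s j are small by the factor c and go into the error.
  have hsplit : monomial (m + Finsupp.single j (s j)) (1 : K) =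
      monomial m 1 * ofPolynomial j (p j) + ∑ k ∈ (p j).support.erase (s j),
        (-(p j).coeff k) • monomial (m + Finsupp.single j k) (1 : K) := by
    rw [monomial_mul_ofPolynomial, ← Finset.add_sum_erase _ _ hs, (hp j).coeff_eq_one, one_smul]
    simp [neg_smul]
  rw [hsplit]
  refine ApproxDivision.add hρ ?_ (ApproxDivision.sum hρ hC hw.le (by positivity) _ fun k hk => ?_)
  · refine ApproxDivision.mul (P := fun j => ofPolynomial j (p j)) hC hw.le (by positivity)
      (isRestricted_monomial _ _ _) ((CoeffBound.monomial hρ m 1).mono ?_) j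
    rw [norm_one, one_mul]
    nlinarith [hCs j]
  rcases lt_or_gt_of_ne (Finset.ne_of_mem_erase hk) with hks | hks
  · have := ih (m + Finsupp.single j k).degree (by rw [← hd]; simpa using hks) _ rfl
    have hb : ‖-(p j).coeff k‖ * (m + Finsupp.single j k).prod (ρ · ^ ·) ≤
        m.prod (ρ · ^ ·) * ρ j ^ s j := by
      rw [weight_add, weight_single, norm_neg, mul_left_comm]
      exact mul_le_mul_of_nonneg_left ((hp j).le k) hwm.le
    refine (this.smul (-(p j).coeff k)).mono hC hb ?_
    rw [mul_left_comm]
    exact mul_le_mul_of_nonneg_left hb hc0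
  · refine ApproxDivision.of_coeffBound hC hw.le
      (((CoeffBound.monomial hρ _ 1).smul _).mono ?_)
    rw [weight_add, weight_single, norm_neg, norm_one, one_mul, mul_left_comm, mul_left_comm c]
    exact mul_le_mul_of_nonneg_left ((hp j).le_of_lt k hks) hwm.le

/-- Truncating f costs an error c * t; the remaining monomials are divided one by one, and the
ultrametric inequality keeps the bounds of the sum. -/
theorem approxDivision_of_isRestricted (hρ : ∀ j, 0 < ρ j) {c : ℝ} (hc0 : 0 < c) (hC : 0 ≤ C)
    {p : σ → Polynomial K} {s : σ → ℕ} (hp : ∀ j, IsDistinguished (ρ j) c (s j) (p j))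
    (hCs : ∀ j, 1 ≤ C * ρ j ^ s j) (hf : IsRestricted ρ f) (ht : 0 < t) (hft : CoeffBound ρ f t) :
    ApproxDivision ρ (fun j => ofPolynomial j (p j)) {i | ∀ j, i j < s j} C t (c * t) f := by
  obtain ⟨T, hT⟩ := exists_sum_monomial_coeffBound hf (mul_pos hc0 ht)
  rw [← sub_add_cancel f (∑ i ∈ T, coeff i f • monomial i (1 : K))]
  refine (ApproxDivision.of_coeffBound hC ht.le hT).add hρ
    (ApproxDivision.sum hρ hC ht.le (by positivity) T fun i _ => ?_)
  refine ((approxDivision_monomial hρ hc0.le hC hp hCs i).smul (coeff i f)).mono hC (hft i) ?_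
  rw [mul_left_comm]
  exact mul_le_mul_of_nonneg_left (hft i) hc0.le

/-- Division of restricted power series by distinguished polynomials in the single variables. -/
theorem exists_division [CompleteSpace K] (hρ : ∀ j, 0 < ρ j) {c : ℝ} (hc0 : 0 < c) (hc1 : c < 1)
    {p : σ → Polynomial K} {s : σ → ℕ} (hp : ∀ j, IsDistinguished (ρ j) c (s j) (p j))
    (hf : IsRestricted ρ f) (ht : 0 < t) (hft : CoeffBound ρ f t) :
    ∃ (q : σ → MvPowerSeries σ K) (e : MvPowerSeries σ K), (∀ j, IsRestricted ρ (q j)) ∧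
      (∀ i, i ∉ {i : σ →₀ ℕ | ∀ j, i j < s j} → coeff i e = 0) ∧ CoeffBound ρ e t ∧
      f = ∑ j, q j * ofPolynomial j (p j) + e := by
  classical
  set S := {i : σ →₀ ℕ | ∀ j, i j < s j}
  have hS : S.Finite := (Set.finite_Iic (Finsupp.equivFunOnFinite.symm s)).subset
    fun i hi j => (hi j).le
  -- Cancelling X_j^(s j) divides the weight by ρ j ^ s j, so C must dominate each inverse.
  obtain ⟨C, hC, hCs⟩ : ∃ C : ℝ, 0 ≤ C ∧ ∀ j, 1 ≤ C * ρ j ^ s j := by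
    refine ⟨∑ j, (ρ j ^ s j)⁻¹, Finset.sum_nonneg fun j _ => (inv_pos.2 (pow_pos (hρ j) _)).le,
      fun j => ?_⟩
    rw [← div_le_iff₀ (pow_pos (hρ j) _), one_div]
    exact Finset.single_le_sum (f := fun j => (ρ j ^ s j)⁻¹)
      (fun j _ => (inv_pos.2 (pow_pos (hρ j) _)).le) (Finset.mem_univ j)
  have step (l : ℕ) (g : MvPowerSeries σ K) (hg : IsRestricted ρ g ∧ CoeffBound ρ g (t * c ^ l)) :
      ∃ (q : σ → MvPowerSeries σ K) (e : MvPowerSeries σ K),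
        (∀ j, IsRestricted ρ (q j)) ∧ (∀ j, CoeffBound ρ (q j) (C * (t * c ^ l))) ∧
        (∀ i ∉ S, coeff i e = 0) ∧ CoeffBound ρ e (t * c ^ l) ∧
        IsRestricted ρ (g - (∑ j, q j * ofPolynomial j (p j) + e)) ∧
        CoeffBound ρ (g - (∑ j, q j * ofPolynomial j (p j) + e)) (t * c ^ (l + 1)) := by
    obtain ⟨q, e, hq, hqb, he, heb, hr⟩ :=
      approxDivision_of_isRestricted hρ hc0 hC hp hCs hg.1 (by positivity) hg.2
    refine ⟨q, e, hq, hqb, he, heb, isRestricted_sub hg.1 (isRestricted.add ρ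
      (isRestricted_sum _ fun j _ => isRestricted.mul ρ (hq j) (isRestricted_ofPolynomial ρ j _))
      (isRestricted_of_support_subset hS he ρ)), hr.mono (by rw [pow_succ]; linarith)⟩
  choose! q e hq hqb he heb hr hrb using step
  -- Successive errors: each approximate division shrinks the bound by c, so quotients and
  -- remainders sum to geometrically convergent series.
  let F : ℕ → MvPowerSeries σ K := fun l => Nat.rec f
    (fun l g => g - (∑ j, q l g j * ofPolynomial j (p j) + e l g)) l
  have hF0 : F 0 = f := rfl
  have hFs (l : ℕ) : F (l + 1) =
      F l - (∑ j, q l (F l) j * ofPolynomial j (p j) + e l (F l)) := rfl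
  have hF (l : ℕ) : IsRestricted ρ (F l) ∧ CoeffBound ρ (F l) (t * c ^ l) := by
    induction l with
    | zero => exact ⟨hf, by simpa [hF0] using hft⟩
    | succ l ih => rw [hFs]; exact ⟨hr l _ ih, hrb l _ ih⟩
  have hQ (j : σ) := exists_isRestricted_sum hρ hc0.le hc1 (mul_nonneg hC ht.le)
    (F := fun l => q l (F l) j) (fun l => hq l _ (hF l) j)
    (fun l => (hqb l _ (hF l) j).mono (mul_assoc _ _ _).ge)
  choose Q hQr hQb _ using hQ
  obtain ⟨E, -, hEb, hE⟩ := exists_isRestricted_sum hρ hc0.le hc1 ht.le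
    (F := fun l => e l (F l))
    (fun l => isRestricted_of_support_subset hS (he l _ (hF l)) ρ) (fun l => heb l _ (hF l))
  -- The tail estimate at m = 0, with empty partial sum, is the bound t on E.
  refine ⟨Q, E, hQr, fun i hi => hE i fun l => he l _ (hF l) i hi, by simpa using hEb 0, ?_⟩
  have htel (m : ℕ) : f = F m + (∑ j, (∑ l ∈ Finset.range m, q l (F l) j) * ofPolynomial j (p j) +
      ∑ l ∈ Finset.range m, e l (F l)) := by
    induction m with
    | zero => simp [hF0]
    | succ m ih =>
      rw [hFs]
      simp only [Finset.sum_range_succ, add_mul, Finset.sum_add_distrib]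
      linear_combination ih
  have hPb (j : σ) : CoeffBound ρ (ofPolynomial j (p j)) (ρ j ^ s j) :=
    CoeffBound.sum hρ (pow_pos (hρ j) _).le _ fun k _ => (CoeffBound.monomial hρ _ _).mono <| by
      rw [weight_single]; exact (hp j).le k
  let D := ∑ j, ρ j ^ s j
  have hD : 0 ≤ D := Finset.sum_nonneg fun j _ => (pow_pos (hρ j) _).le
  have hrem (m : ℕ) : CoeffBound ρ (f - (∑ j, Q j * ofPolynomial j (p j) + E))
      ((1 + C * D) * t * c ^ m) := by
    have heq : f - (∑ j, Q j * ofPolynomial j (p j) + E) =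
        F m - (∑ j, (Q j - ∑ l ∈ Finset.range m, q l (F l) j) * ofPolynomial j (p j)) -
          (E - ∑ l ∈ Finset.range m, e l (F l)) := by
      simp only [sub_mul, Finset.sum_sub_distrib]
      linear_combination htel m
    have hcm : 0 ≤ t * c ^ m := by positivity
    have hle : t * c ^ m ≤ (1 + C * D) * t * c ^ m := by nlinarith [mul_nonneg hC hD]
    rw [heq]
    refine (((hF m).2.mono hle).sub hρ (CoeffBound.sum hρ (hcm.trans hle) _ fun j _ => ?_)).sub hρ
      ((hEb m).mono hle)
    refine ((hQb j m).mul hρ (by positivity) (pow_pos (hρ j) _).le (hPb j)).mono ?_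
    have hjD : ρ j ^ s j ≤ D := Finset.single_le_sum (f := fun j => ρ j ^ s j)
      (fun j _ => (pow_pos (hρ j) _).le) (Finset.mem_univ j)
    have := mul_le_mul_of_nonneg_left hjD (mul_nonneg hC hcm)
    nlinarith
  have hlim : Tendsto (fun m => (1 + C * D) * t * c ^ m) atTop (𝓝 0) := by
    simpa using (tendsto_pow_atTop_nhds_zero_of_lt_one hc0.le hc1).const_mul ((1 + C * D) * t)
  refine sub_eq_zero.1 (CoeffBound.eq_zero hρ fun i => ?_)
  exact ge_of_tendsto' hlim fun m => hrem m i

end Division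

end MvPowerSeries

namespace MvPowerSeries

theorem IsDistinguished.mono {K : Type*} [NormedField K] {ρ c d : ℝ} {s : ℕ} {p : Polynomial K}
    (hρ : 0 < ρ) (h : IsDistinguished ρ c s p) (hcd : c ≤ d) : IsDistinguished ρ d s p :=
  ⟨h.coeff_eq_one, h.le, fun k hk =>
    (h.le_of_lt k hk).trans (mul_le_mul_of_nonneg_right hcd (pow_pos hρ _).le)⟩

theorem aeval_X_eq_ofPolynomial {σ K : Type*} [NormedField K] (j : σ) (p : Polynomial K) :
    Polynomial.aeval (X j : MvPowerSeries σ K) p = ofPolynomial j p := by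
  rw [Polynomial.aeval_eq_sum_range, ofPolynomial, Polynomial.sum_over_range _ (by simp)]
  refine Finset.sum_congr rfl fun k _ => ?_
  rw [X_pow_eq, ← map_smul, smul_eq_mul, mul_one]

end MvPowerSeries

/-! ### Finite remainders, surjectivity and density in the Tate algebras. -/

namespace Tate

open MvPowerSeries

variable {K : Type*} [NormedField K] {n : ℕ} {π : K}

theorem radius_pos (hπ : IsUniformizer π) (r : Fin n → ℚ) (j : Fin n) : 0 < radius π r j :=
  Real.rpow_pos_of_pos hπ.pos _

theorem gaussNorm_nonneg (π : K) (u : Fin n → ℚ) (f : MvPowerSeries (Fin n) K) :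
    0 ≤ gaussNorm π u f :=
  MvPowerSeries.gaussNorm_nonneg _ _ _ norm_nonneg

theorem gaussNorm_le {u : Fin n → ℚ} {f : MvPowerSeries (Fin n) K} {t : ℝ}
    (h : CoeffBound (radius π u) f t) : gaussNorm π u f ≤ t :=
  ciSup_le h

variable [IsUltrametricDist K] {r u : Fin n → ℚ}

/-- A real supremum bounds its family only if the family is bounded above; here the weighted
coefficients tend to zero. -/
theorem coeffBound_gaussNorm (f : tateAlgebra π u) :
    CoeffBound (radius π u) (f : MvPowerSeries (Fin n) K) (gaussNorm π u f) :=
  le_gaussNorm _ _ _ (Tendsto.bddAbove_range_of_cofinite f.2)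

theorem coe_incl (hπ : IsUniformizer π) (hur : u ≤ r) (f : tateAlgebra π r) :
    (incl hπ hur f : MvPowerSeries (Fin n) K) = f :=
  Subalgebra.coe_inclusion (tateAlgebra_le hπ hur) f

/-- The variable `X j` as an element of the Tate algebra. -/
noncomputable def var (π : K) (r : Fin n → ℚ) (j : Fin n) : tateAlgebra π r :=
  ⟨X j, isRestricted_monomial _ _ _⟩

theorem coe_aeval_var (j : Fin n) (p : Polynomial K) :
    (Polynomial.aeval (var π r j) p : MvPowerSeries (Fin n) K) = ofPolynomial j p := by
  rw [← aeval_X_eq_ofPolynomial]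
  exact Polynomial.map_aeval_eq_aeval_map
    (φ := RingHom.id K) (ψ := (tateAlgebra π r).val.toRingHom) rfl p (var π r j) |>.trans
      (by rw [Polynomial.map_id]; rfl)

theorem exists_aeval_mem {F R : Type*} [Field F] [CommRing R] [Algebra F R] (I : Ideal R)
    [FiniteDimensional F (R ⧸ I)] (x : R) :
    ∃ p : Polynomial F, p ≠ 0 ∧ Polynomial.aeval x p ∈ I := by
  refine ⟨minpoly F (Ideal.Quotient.mkₐ F I x), minpoly.ne_zero (IsIntegral.of_finite F _), ?_⟩
  rw [← Ideal.Quotient.eq_zero_iff_mem, ← Ideal.Quotient.mkₐ_eq_mk F,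
    ← Polynomial.aeval_algHom_apply, minpoly.aeval]

/-- Modulo the extension to `K{X; u}` of an ideal of finite codimension in `K{X; r}`, each element
is congruent to a polynomial with exponents in a fixed finite set, without increase of norm. -/
theorem exists_finite_remainder [CompleteSpace K] (hπ : IsUniformizer π) (hur : u ≤ r)
    (I : Ideal (tateAlgebra π r)) [FiniteDimensional K (tateAlgebra π r ⧸ I)] :
    ∃ S : Set (Fin n →₀ ℕ), S.Finite ∧ ∀ (f : tateAlgebra π u) (t : ℝ), 0 < t →
      CoeffBound (radius π u) (f : MvPowerSeries (Fin n) K) t →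
      ∃ e : tateAlgebra π u, (∀ i ∉ S, coeff i (e : MvPowerSeries (Fin n) K) = 0) ∧
        CoeffBound (radius π u) (e : MvPowerSeries (Fin n) K) t ∧
        f - e ∈ I.map (incl hπ hur) := by
  have hρ := radius_pos hπ u
  have hd (j : Fin n) : ∃ c < (1 : ℝ), ∃ (s : ℕ) (p : Polynomial K),
      IsDistinguished (radius π u j) c s p ∧ Polynomial.aeval (var π r j) p ∈ I := by
    obtain ⟨p, hp, hpI⟩ := exists_aeval_mem (F := K) I (var π r j)
    obtain ⟨c, hc, s, a, h⟩ := exists_isDistinguished (hρ j) hp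
    exact ⟨c, hc, s, _, h, by rw [map_mul]; exact I.mul_mem_left _ hpI⟩
  choose c₀ hc₀ s p hp hpI using hd
  -- The division needs one contraction factor for all variables, positive so that truncation errors
  -- c * t are allowed.
  obtain ⟨c, ⟨hcle, hc0⟩, hc1⟩ : ∃ c : ℝ, ((∀ j, c₀ j ≤ c) ∧ 0 < c) ∧ c < 1 := by
    have h : ∀ᶠ c in 𝓝[<] (1 : ℝ), (∀ j, c₀ j ≤ c) ∧ 0 < c := by
      refine mem_nhdsWithin_of_mem_nhds ?_
      exact (eventually_all.2 fun j => le_mem_nhds (hc₀ j)).and (lt_mem_nhds one_pos)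
    exact (h.and self_mem_nhdsWithin).exists
  refine ⟨{i | ∀ j, i j < s j}, (Set.finite_Iic (Finsupp.equivFunOnFinite.symm s)).subset
    fun i hi j => (hi j).le, fun f t ht hft => ?_⟩
  obtain ⟨q, e, hq, he, heb, hfe⟩ :=
    exists_division hρ hc0 hc1 (fun j => (hp j).mono (hρ j) (hcle j)) f.2 ht hft
  have her : IsRestricted (radius π u) e :=
    isRestricted_of_support_subset ((Set.finite_Iic (Finsupp.equivFunOnFinite.symm s)).subset
      fun i hi j => (hi j).le) he _
  refine ⟨⟨e, her⟩, he, heb, ?_⟩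
  have : f - ⟨e, her⟩ = ∑ j, (⟨q j, hq j⟩ : tateAlgebra π u) *
      incl hπ hur (Polynomial.aeval (var π r j) (p j)) := by
    apply Subtype.ext
    simp only [AddSubgroupClass.coe_sub, AddSubmonoidClass.coe_finsetSum, MulMemClass.coe_mul]
    rw [hfe, add_sub_cancel_right]
    exact Finset.sum_congr rfl fun j _ => by
      rw [← coe_aeval_var (π := π) (r := r), coe_incl]
  rw [this]
  exact Ideal.sum_mem _ fun j _ => Ideal.mul_mem_left _ _ (Ideal.mem_map_of_mem _ (hpI j))

theorem Phi_surjective [CompleteSpace K] (hπ : IsUniformizer π) (hur : u ≤ r)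
    (I : Ideal (tateAlgebra π r)) [FiniteDimensional K (tateAlgebra π r ⧸ I)] :
    Function.Surjective (Phi hπ hur I) := by
  intro y
  obtain ⟨f, rfl⟩ := Ideal.Quotient.mk_surjective y
  obtain ⟨S, hS, h⟩ := exists_finite_remainder hπ hur I
  obtain ⟨t, ht, hft⟩ := CoeffBound.of_isRestricted f.2
  obtain ⟨e, he, -, hfe⟩ := h f t ht hft
  refine ⟨Ideal.Quotient.mk I ⟨e, isRestricted_of_support_subset hS he _⟩, ?_⟩
  exact (Ideal.Quotient.eq.2 hfe).symm

/-- An element of the extended ideal is a limit of elements of the ideal. -/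
theorem exists_coeffBound_sub_of_mem_map (hπ : IsUniformizer π) (hur : u ≤ r)
    (I : Ideal (tateAlgebra π r)) {b : tateAlgebra π u} (hb : b ∈ I.map (incl hπ hur)) :
    ∀ ε > 0, ∃ g ∈ I, CoeffBound (radius π u)
      ((b - incl hπ hur g : tateAlgebra π u) : MvPowerSeries (Fin n) K) ε := by
  have hρ := radius_pos hπ u
  refine Submodule.span_induction (p := fun b _ => ∀ ε > 0, ∃ g ∈ I, CoeffBound (radius π u)
      ((b - incl hπ hur g : tateAlgebra π u) : MvPowerSeries (Fin n) K) ε) ?_ ?_ ?_ ?_ hb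
  · rintro _ ⟨g, hg, rfl⟩ ε hε
    exact ⟨g, hg, by simpa using CoeffBound.zero hε.le⟩
  · exact fun ε hε => ⟨0, I.zero_mem, by simpa using CoeffBound.zero hε.le⟩
  · intro x y _ _ hx hy ε hε
    obtain ⟨g, hg, hgb⟩ := hx ε hε
    obtain ⟨g', hg', hgb'⟩ := hy ε hε
    refine ⟨g + g', I.add_mem hg hg', ?_⟩
    rw [map_add, add_sub_add_comm]
    exact hgb.add hρ hgb'
  · intro a x _ hx ε hε
    obtain ⟨ta, hta, ha⟩ := CoeffBound.of_isRestricted a.2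
    obtain ⟨g, hg, hgb⟩ := hx (ε / ta) (by positivity)
    obtain ⟨tg, htg, hgt⟩ := CoeffBound.of_isRestricted (incl hπ hur g).2
    obtain ⟨T, hT⟩ := exists_sum_monomial_coeffBound a.2 (div_pos hε htg)
    -- A polynomial truncation of a lies in K{X;r}, so multiplying g by it stays in I. Its precision
    -- ε / tg is chosen after g, whose norm enters the error.
    let a' : tateAlgebra π r := ∑ i ∈ T, coeff i (a : MvPowerSeries (Fin n) K) •
      ⟨monomial i 1, isRestricted_monomial _ _ _⟩
    have ha' : ((incl hπ hur a' : tateAlgebra π u) : MvPowerSeries (Fin n) K) =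
        ∑ i ∈ T, coeff i (a : MvPowerSeries (Fin n) K) • monomial i 1 :=
      map_sum (tateAlgebra π r).val _ _
    refine ⟨a' * g, I.mul_mem_left _ hg, ?_⟩
    have : a • x - incl hπ hur (a' * g) =
        a * (x - incl hπ hur g) + (a - incl hπ hur a') * incl hπ hur g := by
      rw [smul_eq_mul, map_mul]
      ring
    rw [this]
    refine CoeffBound.add hρ ?_ ?_
    · exact (ha.mul hρ hta.le (by positivity) hgb).mono (mul_div_cancel₀ _ hta.ne').le
    · refine CoeffBound.mono (CoeffBound.mul hρ (by positivity) htg.le ?_ hgt)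
        (div_mul_cancel₀ _ htg.ne').le
      rw [AddSubgroupClass.coe_sub, ha']
      exact hT

/-- The lifts of the class of f are the f - g with g in I, so a zero infimum means approximability
of f by I. -/
theorem quotSeminorm_eq_zero_iff (I : Ideal (tateAlgebra π r)) (hπ : IsUniformizer π) (hur : u ≤ r)
    (f : tateAlgebra π r) :
    quotSeminorm u I (Ideal.Quotient.mk I f) = 0 ↔
      ∀ ε > 0, ∃ g ∈ I, CoeffBound (radius π u)
        ((incl hπ hur (f - g) : tateAlgebra π u) : MvPowerSeries (Fin n) K) ε := by
  have hne : {t : ℝ | ∃ g : tateAlgebra π r, Ideal.Quotient.mk I g = Ideal.Quotient.mk I f ∧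
      gaussNorm π u (g : MvPowerSeries (Fin n) K) = t}.Nonempty := ⟨_, f, rfl, rfl⟩
  have hnn : ∀ t ∈ {t : ℝ | ∃ g : tateAlgebra π r, Ideal.Quotient.mk I g = Ideal.Quotient.mk I f ∧
      gaussNorm π u (g : MvPowerSeries (Fin n) K) = t}, 0 ≤ t := by
    rintro _ ⟨g, -, rfl⟩
    exact gaussNorm_nonneg _ _ _
  constructor
  · intro h ε hε
    rw [← h] at hε
    obtain ⟨_, ⟨g, hg, rfl⟩, hgt⟩ := exists_lt_of_csInf_lt hne hε
    refine ⟨f - g, Ideal.Quotient.eq.1 hg.symm, ?_⟩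
    have hb := coeffBound_gaussNorm (incl hπ hur g)
    rw [coe_incl] at hb
    rw [sub_sub_cancel, coe_incl]
    exact hb.mono hgt.le
  · intro h
    refine le_antisymm (le_of_forall_pos_le_add fun ε hε => ?_) (le_csInf hne hnn)
    obtain ⟨g, hg, hb⟩ := h ε hε
    rw [coe_incl] at hb
    have hmem : f - g - f ∈ I := by simpa using hg
    rw [zero_add]
    exact (csInf_le ⟨0, hnn⟩ ⟨f - g, Ideal.Quotient.eq.2 hmem, rfl⟩).trans (gaussNorm_le hb)

end Tate

/-! ### Closedness of the extended ideal and conclusion. -/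

section Closed

open MvPowerSeries Tate

/-- The extension to `K{X; u}` of an ideal of finite codimension in `K{X; r}` contains the limits
of its elements. -/
theorem Tate.mem_map_of_forall_coeffBound {K : Type*} [NontriviallyNormedField K]
    [IsUltrametricDist K] [CompleteSpace K] {n : ℕ} {π : K} {r u : Fin n → ℚ}
    (hπ : IsUniformizer π) (hur : u ≤ r)
    (I : Ideal (tateAlgebra π r)) [FiniteDimensional K (tateAlgebra π r ⧸ I)] {f : tateAlgebra π u}
    (h : ∀ ε > 0, ∃ g ∈ I.map (incl hπ hur), CoeffBound (radius π u)
      ((f - g : tateAlgebra π u) : MvPowerSeries (Fin n) K) ε) : f ∈ I.map (incl hπ hur) := by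
  obtain ⟨S, hS, hdiv⟩ := exists_finite_remainder hπ hur I
  have := hS.fintype
  let L : (S → K) →ₗ[K] tateAlgebra π u :=
    Fintype.linearCombination K fun i : S =>
      ⟨monomial (i : Fin n →₀ ℕ) 1, isRestricted_monomial _ _ _⟩
  have hL (e : tateAlgebra π u) (he : ∀ i ∉ S, coeff i (e : MvPowerSeries (Fin n) K) = 0) :
      L (fun i : S => coeff (i : Fin n →₀ ℕ) (e : MvPowerSeries (Fin n) K)) = e := by
    classical
    apply Subtype.ext
    ext k
    have : ((L fun i : S => coeff (i : Fin n →₀ ℕ) (e : MvPowerSeries (Fin n) K) : tateAlgebra π u) :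
        MvPowerSeries (Fin n) K) = ∑ i : S, coeff (i : Fin n →₀ ℕ) (e : MvPowerSeries (Fin n) K) •
          monomial (i : Fin n →₀ ℕ) 1 := map_sum (tateAlgebra π u).val _ _
    rw [this, map_sum]
    simp only [coeff_smul, coeff_monomial, mul_ite, mul_one, mul_zero]
    by_cases hk : k ∈ S
    · rw [Finset.sum_eq_single ⟨k, hk⟩ (fun i _ hi => if_neg fun h => hi (Subtype.ext h.symm))
        (by simp)]
      simp
    · rw [he k hk]
      exact Finset.sum_eq_zero fun i _ => if_neg fun h : k = i => hk (h ▸ i.2)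
  -- Coefficient vectors of the polynomials supported in S that lie in J; it suffices that the
  -- remainder of f gives a point of M.
  let M : Submodule K (S → K) := ((I.map (incl hπ hur)).restrictScalars K).comap L
  have hM : IsClosed (M : Set (S → K)) := M.closed_of_finiteDimensional
  obtain ⟨t, ht, hft⟩ := CoeffBound.of_isRestricted f.2
  obtain ⟨e, he, -, hfe⟩ := hdiv f t ht hft
  let v : S → K := fun i => coeff (i : Fin n →₀ ℕ) (e : MvPowerSeries (Fin n) K)
  have hv : v ∈ closure (M : Set (S → K)) := by
    have hε (l : ℕ) : (0 : ℝ) < 1 / (l + 1) := by positivity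
    choose g hg hgb using fun l : ℕ => h _ (hε l)
    -- Since f - g l is small, so is its remainder e' l, and e - e' l lies in J; hence v is a limit
    -- of points of M.
    choose e' he' heb' hfe' using fun l : ℕ => hdiv (f - g l) _ (hε l) (hgb l)
    refine mem_closure_of_tendsto (b := atTop)
      (f := fun (l : ℕ) (i : S) => v i - coeff (i : Fin n →₀ ℕ) (e' l : MvPowerSeries (Fin n) K))
      ?_ (Eventually.of_forall fun l => ?_)
    · refine tendsto_pi_nhds.2 fun i => ?_
      have hw := weight_pos (radius_pos hπ u) (i : Fin n →₀ ℕ)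
      have : Tendsto (fun l => coeff (i : Fin n →₀ ℕ) (e' l : MvPowerSeries (Fin n) K)) atTop
          (𝓝 0) := by
        refine squeeze_zero_norm (a := fun l : ℕ => 1 / ((l : ℝ) + 1) /
          (i : Fin n →₀ ℕ).prod (radius π u · ^ ·)) (fun l => ?_) ?_
        · rw [le_div_iff₀ hw]
          exact heb' l i
        · simpa using tendsto_one_div_add_atTop_nhds_zero_nat.div_const
            ((i : Fin n →₀ ℕ).prod (radius π u · ^ ·))
      simpa using this.const_sub (v i)
    · have hmem : e - e' l ∈ I.map (incl hπ hur) := by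
        have := Ideal.add_mem (I.map (incl hπ hur)) (Ideal.sub_mem _ (hfe' l) hfe) (hg l)
        convert this using 1
        ring
      change L (v - fun i : S => coeff (i : Fin n →₀ ℕ) (e' l : MvPowerSeries (Fin n) K)) ∈
        I.map (incl hπ hur)
      rw [map_sub, hL e he, hL _ (he' l)]
      exact hmem
  rw [hM.closure_eq] at hv
  have heI : e ∈ I.map (incl hπ hur) := by
    rw [← hL e he]
    exact hv
  simpa using Ideal.add_mem _ hfe heI

end Closed

theorem mainTheorem5 {K : Type*} [NontriviallyNormedField K] [IsUltrametricDist K]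
    [CompleteSpace K] (π : K) (hπ : Tate.IsUniformizer π) {n : ℕ} (r u : Fin n → ℚ)
    (hur : u ≤ r) (I : Ideal (Tate.tateAlgebra π r))
    (hI : FiniteDimensional K (Tate.tateAlgebra π r ⧸ I)) :
    Function.Surjective (Tate.Phi hπ hur I) ∧
      {x | Tate.Phi hπ hur I x = 0} = {x | Tate.quotSeminorm u I x = 0} := by
  refine ⟨Tate.Phi_surjective hπ hur I, Set.ext fun x => ?_⟩
  obtain ⟨f, rfl⟩ := Ideal.Quotient.mk_surjective x
  have hPhi : Tate.Phi hπ hur I (Ideal.Quotient.mk I f) = 0 ↔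
      Tate.incl hπ hur f ∈ I.map (Tate.incl hπ hur) := Ideal.Quotient.eq_zero_iff_mem
  refine (hPhi.trans ?_).trans (Tate.quotSeminorm_eq_zero_iff I hπ hur f).symm
  constructor
  · intro h ε hε
    obtain ⟨g, hg, hb⟩ := Tate.exists_coeffBound_sub_of_mem_map hπ hur I h ε hε
    exact ⟨g, hg, by rwa [map_sub]⟩
  · intro h
    refine Tate.mem_map_of_forall_coeffBound hπ hur I fun ε hε => ?_
    obtain ⟨g, hg, hb⟩ := h ε hε
    exact ⟨_, Ideal.mem_map_of_mem _ hg, by rwa [← map_sub]⟩
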